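/- A $k$-ranking of a finite simple graph $G$ is a labelling $f : V(G) \to \{1,\dots,k\}$ such that every path between two distinct vertices with the same label passes through a vertex with a larger label. The rank number $\chi_r(G)$ is the smallest $k$ for which $G$ has a $k$-ranking. For an integer $n \ge 0$, the triangle grid of side $n$ is the graph whose vertices are the lattice points $(i,j)$ with integers $i,j\ge 0$ and $i+j\le n-1$ (so that its rows have $n, n-1, \dots, 1$ vertices), two vertices being adjacent if they agree in one coordinate and differ by exactly $1$ in the other. Let $\mathrm{tri}_n$ be its rank number. Then for every integer $n \ge 0$, $$\mathrm{tri}_n \;\ge\; \frac{5}{3}\left\lfloor \frac{n}{2}\right\rfloor - \frac{34}{9}.$$ -/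

import Mathlib

/-- `f` is a `k`-ranking of `G`: a labelling of the vertices by integers from `1` to `k` such that
every path between two distinct vertices with the same label passes through a vertex with a
larger label. -/
def IsRanking {V : Type*} (G : SimpleGraph V) (k : ℕ) (f : V → ℕ) : Prop :=
  (∀ v, 1 ≤ f v ∧ f v ≤ k) ∧
    ∀ u v : V, u ≠ v → f u = f v → ∀ p : G.Walk u v, p.IsPath → ∃ w ∈ p.support, f u < f w

/-- Every finite graph has a `k`-ranking for some `k`, so that the rank number below is
a genuine minimum. -/
theorem exists_isRanking {V : Type*} [Finite V] (G : SimpleGraph V) :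
    ∃ (k : ℕ) (f : V → ℕ), IsRanking G k f := by
  obtain ⟨n, ⟨e⟩⟩ := Finite.exists_equiv_fin V
  refine ⟨n, fun v => (e v : ℕ) + 1, fun v => ⟨Nat.succ_pos _, (e v).isLt⟩, ?_⟩
  intro u v huv h
  exact absurd (e.injective (Fin.ext (Nat.succ_injective h))) huv

/-- The rank number `χ_r(G)`: the smallest `k` for which `G` has a `k`-ranking. -/
noncomputable def rankNumber {V : Type*} (G : SimpleGraph V) : ℕ :=
  sInf {k : ℕ | ∃ f : V → ℕ, IsRanking G k f}

/-- The vertices of the triangle grid of side `n`: the points `(i, j)` of the integer lattice with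
`i, j ≥ 0` and `i + j ≤ n - 1`. They form rows of `n, n - 1, …, 1` vertices. -/
abbrev TriangleVertex (n : ℕ) : Type := {p : ℕ × ℕ // p.1 + p.2 < n}

instance triangleVertexFinite (n : ℕ) : Finite (TriangleVertex n) :=
  Set.Finite.to_subtype <| (Set.finite_Iic ((n, n) : ℕ × ℕ)).subset fun p hp =>
    Prod.mk_le_mk.2 ⟨by have : p.1 + p.2 < n := hp; omega, by have : p.1 + p.2 < n := hp; omega⟩

/-- The triangle grid of side `n`: the subgraph of the square lattice induced on
`TriangleVertex n`; two vertices are adjacent when they agree in one coordinate and differ by `1`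
in the other. -/
def triangleGrid (n : ℕ) : SimpleGraph (TriangleVertex n) where
  Adj p q :=
    (p.1.1 = q.1.1 ∧ (p.1.2 + 1 = q.1.2 ∨ q.1.2 + 1 = p.1.2)) ∨
      (p.1.2 = q.1.2 ∧ (p.1.1 + 1 = q.1.1 ∨ q.1.1 + 1 = p.1.1))
  symm := ⟨fun p q h => by omega⟩
  loopless := ⟨fun p h => by omega⟩

/-!
Delete vertices of a ranked graph one at a time, always one that carries the largest label in the
current connected component. That label occurs only once there, so the largest label drops at
every step, and a ranking of the triangle grid needs `n` labels once the deletion can be continued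
for `n` steps. To see that it can, keep a corner `c = (a, b)` whose row has lost no vertex from `c`
on, and such that `a + b` is at most the number of deleted vertices outside the quadrant above `c`.
Move `c` along its row to the first column that has lost no vertex in the quadrant, delete a vertex,
and move `c` along that column to the first row that has lost no vertex in the quadrant. Every line
that is skipped contains a deleted vertex which leaves the quadrant, so the bound on `a + b`
survives. The corner moves through vertices that were present before the deletion, so the next
component lies in the previous one.
-/

section Ranking

variable {V : Type*} {G H : SimpleGraph V} {k : ℕ} {f : V → ℕ}

theorem exists_isRanking_rankNumber [Finite V] (G : SimpleGraph V) :
    ∃ f : V → ℕ, IsRanking G (rankNumber G) f :=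
  Nat.sInf_mem (exists_isRanking G)

theorem IsRanking.of_le (hf : IsRanking G k f) (hHG : H ≤ G) : IsRanking H k f := by
  refine ⟨hf.1, fun u v huv hlabel p hp => ?_⟩
  obtain ⟨w, hw, hlt⟩ := hf.2 u v huv hlabel (p.mapLe hHG) (hp.mapLe hHG)
  exact ⟨w, by simpa using hw, hlt⟩

theorem IsRanking.eq_of_reachable (hf : IsRanking G k f) {u v : V} (huv : G.Reachable u v)
    (hmax : ∀ w, G.Reachable u w → f w ≤ f u) (hlabel : f u = f v) : u = v := by
  classical
  by_contra hne
  obtain ⟨p, hp⟩ := huv.exists_isPath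
  obtain ⟨w, hw, hlt⟩ := hf.2 u v hne hlabel p hp
  exact hlt.not_ge (hmax w ⟨p.takeUntil w hw⟩)

theorem IsRanking.exists_forall_reachable_ne_le (hf : IsRanking G k f) {u : V} {K : ℕ}
    (hK : ∀ w, G.Reachable u w → f w ≤ K + 1) :
    ∃ v, ∀ w, G.Reachable u w → w ≠ v → f w ≤ K := by
  by_cases htop : ∃ v, G.Reachable u v ∧ f v = K + 1
  · obtain ⟨v, huv, hv⟩ := htop
    refine ⟨v, fun w huw hwv => Nat.le_of_lt_succ ((hK w huw).lt_of_ne fun hw => hwv ?_)⟩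
    exact (hf.eq_of_reachable (huv.symm.trans huw)
      (fun z hvz => (hK z (huv.trans hvz)).trans hv.ge) (hv.trans hw.symm)).symm
  · push Not at htop
    exact ⟨u, fun w huw _ => Nat.le_of_lt_succ ((hK w huw).lt_of_ne (htop w huw))⟩

end Ranking

section InducedOn

variable {V : Type*} {G : SimpleGraph V} {U U' : Set V} {u v : V}

/-- The subgraph of `G` induced on `U`. The vertices outside `U` are kept as isolated points, so
that the graphs for different `U` have the same vertex type and can be compared. -/
def inducedOn (G : SimpleGraph V) (U : Set V) : SimpleGraph V :=
  ((⊤ : G.Subgraph).induce U).spanningCoe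

theorem inducedOn_adj : (inducedOn G U).Adj u v ↔ u ∈ U ∧ v ∈ U ∧ G.Adj u v := by
  simp [inducedOn]

theorem inducedOn_le : inducedOn G U ≤ G :=
  SimpleGraph.Subgraph.spanningCoe_le _

theorem inducedOn_mono (hU : U ⊆ U') : inducedOn G U ≤ inducedOn G U' :=
  SimpleGraph.Subgraph.spanningCoe_le_of_le (SimpleGraph.Subgraph.induce_mono_right hU)

theorem mem_of_reachable_inducedOn (huv : (inducedOn G U).Reachable u v) (hu : u ∈ U) :
    v ∈ U := by
  by_cases h : u = v
  · exact h ▸ hu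
  · obtain ⟨w, hw⟩ := huv.nonempty_neighborSet_right h
    exact (inducedOn_adj.1 hw).1

end InducedOn

theorem exists_forall_ne_add_card_le {α : Type*} (S : Finset α) (g : α → ℕ) (b : ℕ) :
    ∃ c ≥ b, (∀ p ∈ S, g p ≠ c) ∧
      c + (S.filter (c ≤ g ·)).card ≤ b + (S.filter (b ≤ g ·)).card := by
  by_cases hb : ∀ p ∈ S, g p ≠ b
  · exact ⟨b, le_rfl, hb, le_rfl⟩
  · push Not at hb
    obtain ⟨p, hp, hpb⟩ := hb
    have hcard : (S.filter (b + 1 ≤ g ·)).card < (S.filter (b ≤ g ·)).card := by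
      refine Finset.card_lt_card <| (Finset.ssubset_iff_of_subset ?_).2 ⟨p, ?_, ?_⟩
      · exact Finset.monotone_filter_right S fun q _ hq => Nat.le_of_succ_le hq
      · exact Finset.mem_filter.2 ⟨hp, hpb.ge⟩
      · simp [hpb]
    obtain ⟨c, hbc, hc, hle⟩ := exists_forall_ne_add_card_le S g (b + 1)
    exact ⟨c, by omega, hc, by omega⟩
termination_by (S.filter (b ≤ g ·)).card

section TriangleGrid

variable {n : ℕ}

theorem exists_triangleGrid_adj_of_lt {c d : TriangleVertex n} (hcd : c < d) :
    ∃ e, c ≤ e ∧ e < d ∧ (triangleGrid n).Adj e d := by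
  obtain ⟨⟨a, b⟩, hc⟩ := c
  obtain ⟨⟨i, j⟩, hd⟩ := d
  dsimp only at hc hd
  obtain ⟨hi, hj⟩ | ⟨hi, hj⟩ := Prod.mk_lt_mk.1 (Subtype.mk_lt_mk.1 hcd)
  · refine ⟨⟨(i - 1, j), by dsimp only; omega⟩, Prod.mk_le_mk.2 ⟨by omega, hj⟩,
      Prod.mk_lt_mk.2 (.inl ⟨by omega, le_rfl⟩), .inr ⟨rfl, .inl ?_⟩⟩
    exact Nat.sub_add_cancel (Nat.one_le_of_lt hi)
  · refine ⟨⟨(i, j - 1), by dsimp only; omega⟩, Prod.mk_le_mk.2 ⟨hi, by omega⟩,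
      Prod.mk_lt_mk.2 (.inr ⟨le_rfl, by omega⟩), .inl ⟨rfl, .inl ?_⟩⟩
    exact Nat.sub_add_cancel (Nat.one_le_of_lt hj)

theorem reachable_inducedOn_of_Icc_subset {U : Set (TriangleVertex n)} {c d : TriangleVertex n}
    (hcd : c ≤ d) (hU : Set.Icc c d ⊆ U) : (inducedOn (triangleGrid n) U).Reachable c d := by
  induction d using WellFoundedLT.induction with
  | ind d ih =>
    obtain rfl | hlt := hcd.eq_or_lt
    · rfl
    · obtain ⟨e, hce, hed, hadj⟩ := exists_triangleGrid_adj_of_lt hlt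
      have hadj' : (inducedOn (triangleGrid n) U).Adj e d :=
        inducedOn_adj.2 ⟨hU ⟨hce, hed.le⟩, hU ⟨hcd, le_rfl⟩, hadj⟩
      exact (ih e hed hce ((Set.Icc_subset_Icc_right hed.le).trans hU)).trans hadj'.reachable

/-- For `c = (a, b)`, the sum of `a + b` and the number of points of `R` in the quadrant above
`c`: the potential of the pair `(c, R)`. It grows by at most one when a vertex is added to `R`,
and it does not grow when `c` passes a row or column that contains one of these points. -/
def cornerPotential (c : TriangleVertex n) (R : Finset (TriangleVertex n)) : ℕ :=
  c.1.1 + c.1.2 + (R.filter (c ≤ ·)).card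

theorem cornerPotential_insert_le (c v : TriangleVertex n) (R : Finset (TriangleVertex n)) :
    cornerPotential c (insert v R) ≤ cornerPotential c R + 1 := by
  have hcard : ((insert v R).filter (c ≤ ·)).card ≤ (R.filter (c ≤ ·)).card + 1 := by
    rw [Finset.filter_insert]
    split_ifs
    · exact Finset.card_insert_le _ _
    · exact Nat.le_succ _
  unfold cornerPotential
  omega

theorem exists_disjoint_column {c : TriangleVertex n} {R : Finset (TriangleVertex n)}
    (h : cornerPotential c R < n) :
    ∃ d, c ≤ d ∧ d.1.2 = c.1.2 ∧ (∀ p ∈ R, d ≤ p → p.1.1 ≠ d.1.1) ∧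
      cornerPotential d R ≤ cornerPotential c R := by
  obtain ⟨⟨a, b⟩, hab⟩ := c
  obtain ⟨a', haa', hmiss, hle⟩ := exists_forall_ne_add_card_le (R.filter (b ≤ ·.1.2)) (·.1.1) a
  simp only [cornerPotential, Finset.filter_filter, Finset.mem_filter, ← Subtype.coe_le_coe,
    Prod.le_def, and_comm (a := b ≤ _)] at h hle hmiss ⊢
  exact ⟨⟨(a', b), by dsimp only; omega⟩, ⟨haa', le_rfl⟩, rfl,
    fun p hp hdp => hmiss p ⟨hp, hdp.2⟩, by dsimp only; omega⟩

theorem exists_disjoint_row {c : TriangleVertex n} {R : Finset (TriangleVertex n)}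
    (h : cornerPotential c R < n) :
    ∃ d, c ≤ d ∧ d.1.1 = c.1.1 ∧ (∀ p ∈ R, d ≤ p → p.1.2 ≠ d.1.2) ∧
      cornerPotential d R ≤ cornerPotential c R := by
  obtain ⟨⟨a, b⟩, hab⟩ := c
  obtain ⟨b', hbb', hmiss, hle⟩ := exists_forall_ne_add_card_le (R.filter (a ≤ ·.1.1)) (·.1.2) b
  simp only [cornerPotential, Finset.filter_filter, Finset.mem_filter, ← Subtype.coe_le_coe,
    Prod.le_def] at h hle hmiss ⊢
  exact ⟨⟨(a, b'), by dsimp only; omega⟩, ⟨le_rfl, hbb'⟩, rfl,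
    fun p hp hdp => hmiss p ⟨hp, hdp.1⟩, by dsimp only; omega⟩

theorem exists_reachable_disjoint_row {c : TriangleVertex n} {R : Finset (TriangleVertex n)}
    (hrow : ∀ p ∈ R, c ≤ p → p.1.2 ≠ c.1.2) (v : TriangleVertex n)
    (h : cornerPotential c R + 1 < n) :
    ∃ e, c ≤ e ∧ (inducedOn (triangleGrid n) (Set.Ici c \ R)).Reachable c e ∧
      (∀ p ∈ insert v R, e ≤ p → p.1.2 ≠ e.1.2) ∧
      cornerPotential e (insert v R) ≤ cornerPotential c R + 1 := by
  obtain ⟨d, hcd, hdc, hcolumn, hd⟩ := exists_disjoint_column (c := c) (R := R) (by omega)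
  have hins := cornerPotential_insert_le d v R
  obtain ⟨e, hde, hed, hrow', he⟩ := exists_disjoint_row (c := d) (R := insert v R) (by omega)
  have hreach_cd : (inducedOn (triangleGrid n) (Set.Ici c \ R)).Reachable c d :=
    reachable_inducedOn_of_Icc_subset hcd fun p hp =>
      ⟨hp.1, fun hpR => hrow p hpR hp.1 (le_antisymm (hp.2.2.trans hdc.le) hp.1.2)⟩
  have hreach_de : (inducedOn (triangleGrid n) (Set.Ici c \ R)).Reachable d e :=
    reachable_inducedOn_of_Icc_subset hde fun p hp =>
      ⟨hcd.trans hp.1, fun hpR => hcolumn p hpR hp.1 (le_antisymm (hp.2.1.trans hed.le) hp.1.1)⟩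
  exact ⟨e, hcd.trans hde, hreach_cd.trans hreach_de, hrow', by omega⟩

theorem IsRanking.le_cornerPotential_add {k K : ℕ} {f : TriangleVertex n → ℕ}
    (hf : IsRanking (triangleGrid n) k f) {c : TriangleVertex n} {R : Finset (TriangleVertex n)}
    (hrow : ∀ p ∈ R, c ≤ p → p.1.2 ≠ c.1.2)
    (hK : ∀ w, (inducedOn (triangleGrid n) (Set.Ici c \ R)).Reachable c w → f w ≤ K) :
    n ≤ cornerPotential c R + K := by
  induction K generalizing c R with
  | zero => exact absurd (hK c .rfl) (Nat.not_le.2 (hf.1 c).1)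
  | succ K ih =>
    by_contra! hlt
    obtain ⟨v, hv⟩ := (hf.of_le inducedOn_le).exists_forall_reachable_ne_le hK
    obtain ⟨e, hce, hreach, hrow', he⟩ := exists_reachable_disjoint_row hrow v (by omega)
    have hsub : Set.Ici e \ ↑(insert v R) ⊆ Set.Ici c \ (R : Set (TriangleVertex n)) :=
      Set.sdiff_subset_sdiff (Set.Ici_subset_Ici.2 hce)
        (Finset.coe_subset.2 (Finset.subset_insert v R))
    have hstep : n ≤ cornerPotential e (insert v R) + K := by
      refine ih hrow' fun w hw => hv w (hreach.trans (hw.mono (inducedOn_mono hsub))) ?_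
      rintro rfl
      have hw_mem := mem_of_reachable_inducedOn hw
        ⟨Set.self_mem_Ici, fun he_mem => hrow' e he_mem le_rfl rfl⟩
      exact hw_mem.2 (Finset.mem_insert_self _ _)
    omega

theorem le_rankNumber_triangleGrid (n : ℕ) : n ≤ rankNumber (triangleGrid n) := by
  obtain ⟨f, hf⟩ := exists_isRanking_rankNumber (triangleGrid n)
  obtain rfl | hn := Nat.eq_zero_or_pos n
  · exact Nat.zero_le _
  · simpa [cornerPotential] using
      hf.le_cornerPotential_add (c := ⟨(0, 0), hn⟩) (R := ∅) (by simp) fun w _ => (hf.1 w).2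

end TriangleGrid

theorem mainTheorem4 (n : ℕ) :
    (5 / 3 : ℝ) * ((n / 2 : ℕ) : ℝ) - 34 / 9 ≤ (rankNumber (triangleGrid n) : ℝ) := by
  have hrank : (n : ℝ) ≤ rankNumber (triangleGrid n) := by
    exact_mod_cast le_rankNumber_triangleGrid n
  have hfloor : ((n / 2 : ℕ) : ℝ) ≤ n / 2 := by exact_mod_cast Nat.cast_div_le (m := n) (n := 2)
  linarith
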